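/- **Theorem 1.1.** Consider the Lagrangian system on the cylinder $\mathbb{R}\times\mathbb{R}/2\pi\mathbb{Z}$ with coordinates $(x,\phi)$ and Lagrangian $$L(x,\phi,\dot x,\dot\phi)=\tfrac12(x^2+1)\dot\phi^2+\tfrac12\dot x^2-x\sin\phi .$$ For every real $\omega>0$ and every $k\in\mathbb{N}=\{0,1,2,\dots\}$ there are functions $x,\phi\in C^2(\mathbb{R})$ that satisfy the Lagrange equations $$\frac{d}{dt}\frac{\partial L}{\partial\dot x}=\frac{\partial L}{\partial x},\qquad \frac{d}{dt}\frac{\partial L}{\partial\dot\phi}=\frac{\partial L}{\partial\phi}$$ for all $t\in\mathbb{R}$ and such that, for all $t\in\mathbb{R}$, 1. $x(t)=-x(-t)$ and $\phi(t)=-\phi(-t)$; 2. $x(t+\omega)=x(t)$ and $\phi(t+\omega)=\phi(t)+2\pi k$. Moreover, solutions of this kind with different $k$ are not homotopic: if $(x_1,\phi_1)$ and $(x_2,\phi_2)$ are $C^2$ solutions satisfying 1 and 2 with $(\omega_1,k_1)$ and $(\omega_2,k_2)$ respectively, where $\omega_1,\omega_2>0$ and $k_1\ne k_2$, then the closed curves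 $$\mathbb{R}/\mathbb{Z}\to\mathbb{R}\times\mathbb{R}/2\pi\mathbb{Z},\qquad s\mapsto\bigl(x_i(\omega_i s),\ \phi_i(\omega_i s)\bmod 2\pi\bigr),\qquad i=1,2,$$ are not freely homotopic. -/

import Mathlib

open Real

/-- The Lagrangian `L(x, φ, ẋ, φ̇) = ½ (x² + 1) φ̇² + ½ ẋ² - x sin φ` of the tube and the ball;
the arguments are, in this order, `x`, `φ`, `ẋ`, `φ̇`. -/
noncomputable def tubeBallLagrangian (q θ v w : ℝ) : ℝ :=
  (1 / 2) * (q ^ 2 + 1) * w ^ 2 + (1 / 2) * v ^ 2 - q * Real.sin θ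

/-- `(x, φ) : ℝ → ℝ²` is a classical (global, `C²`) solution of the Lagrange equations
`d/dt (∂L/∂ẋ) = ∂L/∂x` and `d/dt (∂L/∂φ̇) = ∂L/∂φ` of the Lagrangian `L(x, φ, ẋ, φ̇)`. -/
structure IsLagrangeSolution (L : ℝ → ℝ → ℝ → ℝ → ℝ) (x φ : ℝ → ℝ) : Prop where
  contDiff_x : ContDiff ℝ 2 x
  contDiff_φ : ContDiff ℝ 2 φ
  eq_x : ∀ t : ℝ,
    HasDerivAt (fun s => deriv (fun v => L (x s) (φ s) v (deriv φ s)) (deriv x s))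
      (deriv (fun q => L q (φ t) (deriv x t) (deriv φ t)) (x t)) t
  eq_φ : ∀ t : ℝ,
    HasDerivAt (fun s => deriv (fun w => L (x s) (φ s) (deriv x s) w) (deriv φ s))
      (deriv (fun θ => L (x t) θ (deriv x t) (deriv φ t)) (φ t)) t

/-- `(x, φ)` is a global classical solution of the tube-and-ball system, odd in time, with `x`
`ω`-periodic and `φ` increasing by `2πk` over every time interval of length `ω`. -/
structure IsOddPeriodicMotion (ω : ℝ) (k : ℕ) (x φ : ℝ → ℝ) : Prop where
  isSolution : IsLagrangeSolution tubeBallLagrangian x φ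
  odd_x : ∀ t : ℝ, x t = -x (-t)
  odd_φ : ∀ t : ℝ, φ t = -φ (-t)
  period_x : ∀ t : ℝ, x (t + ω) = x t
  period_φ : ∀ t : ℝ, φ (t + ω) = φ t + 2 * π * k

/-- The configuration space: the cylinder `ℝ × ℝ/2πℤ`. -/
abbrev TubeBallCylinder : Type := ℝ × AddCircle (2 * π)

/-- In the rescaled time `s = t / ω` the motion on the cylinder has period `1`. -/
theorem IsOddPeriodicMotion.periodic {ω : ℝ} {k : ℕ} {x φ : ℝ → ℝ}
    (h : IsOddPeriodicMotion ω k x φ) :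
    Function.Periodic
      (fun s : ℝ => ((x (ω * s), (φ (ω * s) : AddCircle (2 * π))) : TubeBallCylinder)) 1 := by
  intro s
  have e : ω * (s + 1) = ω * s + ω := by ring
  simp only [e, h.period_x, h.period_φ, Prod.mk.injEq, true_and]
  rw [AddCircle.coe_add, mul_comm (2 * π) (k : ℝ), ← nsmul_eq_mul, AddCircle.coe_nsmul,
    AddCircle.coe_period, smul_zero, add_zero]

/-- The closed curve on the cylinder traced by the motion during one period:
the class of `s` is sent to `(x(ω s), φ(ω s) mod 2π)`, `s ∈ ℝ/ℤ`. -/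
noncomputable def IsOddPeriodicMotion.loop {ω : ℝ} {k : ℕ} {x φ : ℝ → ℝ}
    (h : IsOddPeriodicMotion ω k x φ) : C(UnitAddCircle, TubeBallCylinder) where
  toFun := h.periodic.lift
  continuous_toFun := by
    have hx := h.isSolution.contDiff_x.continuous
    have hφ := h.isSolution.contDiff_φ.continuous
    refine continuous_coinduced_dom.mpr ?_
    have hc : Continuous
        (fun s : ℝ => ((x (ω * s), (φ (ω * s) : AddCircle (2 * π))) : TubeBallCylinder)) :=
      (hx.comp (continuous_const_mul ω)).prodMk
        ((AddCircle.continuous_mk' (2 * π)).comp (hφ.comp (continuous_const_mul ω)))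
    exact hc

/-- The value of the closed curve at the class of `s`. -/
theorem IsOddPeriodicMotion.loop_coe {ω : ℝ} {k : ℕ} {x φ : ℝ → ℝ}
    (h : IsOddPeriodicMotion ω k x φ) (s : ℝ) :
    h.loop (s : UnitAddCircle) = (x (ω * s), (φ (ω * s) : AddCircle (2 * π))) := rfl

/-- Motions whose closed curves on the cylinder are freely homotopic have the same winding number. -/
theorem IsOddPeriodicMotion.eq_of_homotopic {ω₁ ω₂ : ℝ} {k₁ k₂ : ℕ} {x₁ φ₁ x₂ φ₂ : ℝ → ℝ}
    (h₁ : IsOddPeriodicMotion ω₁ k₁ x₁ φ₁) (h₂ : IsOddPeriodicMotion ω₂ k₂ x₂ φ₂)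
    (hom : ContinuousMap.Homotopic h₁.loop h₂.loop) : k₁ = k₂ := by
  obtain ⟨F⟩ := hom
  have cov : IsCoveringMap ((↑) : ℝ → AddCircle (2 * π)) := AddCircle.isCoveringMap_coe _
  let H : C(unitInterval × ℝ, AddCircle (2 * π)) :=
    ⟨fun p => (F (p.1, (p.2 : UnitAddCircle))).2, by
      have : Continuous fun s : ℝ => (s : UnitAddCircle) := AddCircle.continuous_mk' 1
      fun_prop⟩
  let f : C(ℝ, ℝ) := ⟨fun s => φ₁ (ω₁ * s), by
    have := h₁.isSolution.contDiff_φ.continuous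
    fun_prop⟩
  have hH0 : ∀ s, H (0, s) = ((f s : ℝ) : AddCircle (2 * π)) := fun s => by
    change (F (0, (s : UnitAddCircle))).2 = _
    rw [F.apply_zero, h₁.loop_coe]
    rfl
  have hH1 : ∀ s, H (1, s) = ((φ₂ (ω₂ * s) : ℝ) : AddCircle (2 * π)) := fun s => by
    change (F (1, (s : UnitAddCircle))).2 = _
    rw [F.apply_one, h₂.loop_coe]
  let G := cov.liftHomotopy H f hH0
  have hG : ∀ p, ((G p : ℝ) : AddCircle (2 * π)) = H p :=
    fun p => congrFun (cov.liftHomotopy_lifts H f hH0) p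
  have hG0 : ∀ s, G (0, s) = φ₁ (ω₁ * s) := cov.liftHomotopy_zero H f hH0
  have hzero : ∀ {ω : ℝ} {k : ℕ} {x φ : ℝ → ℝ}, IsOddPeriodicMotion ω k x φ →
      φ (ω * 1) = φ (ω * 0) + 2 * π * k := fun h => by
    have := h.period_φ 0
    simpa using this
  have hper : ∀ k : ℕ, (((2 * π * k : ℝ)) : AddCircle (2 * π)) = 0 := fun k => by
    rw [mul_comm (2 * π) (k : ℝ), ← nsmul_eq_mul, AddCircle.coe_nsmul, AddCircle.coe_period,
      smul_zero]
  have e1 : (fun t : unitInterval => G (t, 1)) = fun t => G (t, 0) + 2 * π * k₁ := by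
    refine cov.eq_of_comp_eq (by fun_prop) (by fun_prop) ?_ 0 ?_
    · funext t
      simp only [Function.comp_apply, AddCircle.coe_add, hper, add_zero, hG]
      change (F (t, ((1 : ℝ) : UnitAddCircle))).2 = (F (t, ((0 : ℝ) : UnitAddCircle))).2
      rw [AddCircle.coe_period, AddCircle.coe_zero]
    · rw [hG0, hG0, hzero h₁]
  have e2 : (fun s : ℝ => G (1, s)) = fun s => φ₂ (ω₂ * s) + (G (1, 0) - φ₂ (ω₂ * 0)) := by
    have := h₂.isSolution.contDiff_φ.continuous
    refine cov.eq_of_comp_eq (by fun_prop) (by fun_prop) ?_ 0 (by ring)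
    funext s
    simp only [Function.comp_apply, AddCircle.coe_add, AddCircle.coe_sub, hG, hH1]
    simp
  have a1 := congrFun e1 1
  have a2 := congrFun e2 1
  simp only [hzero h₂] at a1 a2
  have : (2 * π) * (k₁ : ℝ) = 2 * π * k₂ := by linarith
  exact_mod_cast mul_left_cancel₀ (by positivity) this

/-- A sequence indexed by `ℤ` that is odd and has period `n`. -/
structure OddPeriodic (n : ℕ) (g : ℤ → ℝ) : Prop where
  odd : ∀ i, g (-i) = -g i
  period : Function.Periodic g (n : ℤ)

/-- Forward difference quotient of a sequence sampled with step `h`. -/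
noncomputable def diffQuot (h : ℝ) (g : ℤ → ℝ) (i : ℤ) : ℝ := (g (i + 1) - g i) / h

/-- Symmetric discretization of the moment of inertia `x² + 1`. -/
noncomputable def inertia (x : ℤ → ℝ) (i : ℤ) : ℝ := (x i ^ 2 + x (i + 1) ^ 2) / 2 + 1

/-- The discrete action over one period. -/
noncomputable def discreteAction (n : ℕ) (h : ℝ) (x φ : ℤ → ℝ) : ℝ :=
  ∑ i ∈ Finset.range n, h * (1 / 2 * inertia x i * diffQuot h φ i ^ 2 + 1 / 2 * diffQuot h x i ^ 2
    - x i * sin (φ i))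

theorem Function.Periodic.sum_range_add_one {n : ℕ} {g : ℤ → ℝ} (hg : Function.Periodic g (n : ℤ)) :
    ∑ i ∈ Finset.range n, g (i + 1) = ∑ i ∈ Finset.range n, g i := by
  have := Finset.sum_range_sub (fun i : ℕ => g i) n
  have h0 := hg 0
  simp only [Finset.sum_sub_distrib, zero_add, Nat.cast_add, Nat.cast_one, Nat.cast_zero] at this h0
  linarith

theorem Function.Periodic.exists_nat_lt {n : ℕ} (hn : 0 < n) {g : ℤ → ℝ}
    (hg : Function.Periodic g (n : ℤ)) (i : ℤ) : ∃ j < n, g i = g j := by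
  have hn' : (n : ℤ) ≠ 0 := by positivity
  have hi : i % n + (i / n) * n = i := Int.emod_add_ediv_mul i n
  have hj : ((i % n).toNat : ℤ) = i % n := Int.toNat_of_nonneg (Int.emod_nonneg _ hn')
  refine ⟨(i % n).toNat, ?_, ?_⟩
  · have := Int.emod_lt_of_pos i (by positivity : (0 : ℤ) < n)
    omega
  · have := hg.int_mul (i / n) (i % n)
    rw [hj, ← this]
    congr 1
    rw [Int.cast_id]
    linarith

theorem Function.Periodic.abs_le_sum {n : ℕ} (hn : 0 < n) {g : ℤ → ℝ}
    (hg : Function.Periodic g (n : ℤ)) (i : ℤ) : |g i| ≤ ∑ j ∈ Finset.range n, |g j| := by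
  obtain ⟨j, hj, e⟩ := hg.exists_nat_lt hn i
  rw [e]
  exact Finset.single_le_sum (f := fun j : ℕ => |g j|) (fun _ _ => abs_nonneg _)
    (Finset.mem_range.2 hj)

theorem abs_sub_le_of_increment {g : ℤ → ℝ} {d : ℝ} (hd : ∀ i, |g (i + 1) - g i| ≤ d)
    (i : ℤ) (m : ℕ) : |g (i + m) - g i| ≤ m * d := by
  induction m with
  | zero => simp
  | succ m ih =>
    have h1 := hd (i + m)
    have e : g (i + (m + 1 : ℕ)) - g i = (g (i + m + 1) - g (i + m)) + (g (i + m) - g i) := by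
      push_cast; ring_nf
    rw [e]
    refine (abs_add_le _ _).trans ?_
    push_cast
    linarith

/-- A periodic sequence with small increments is bounded in terms of its mean. -/
theorem Function.Periodic.abs_le_of_increment {n : ℕ} (hn : 0 < n) {g : ℤ → ℝ} {ω h D B : ℝ}
    (hh : 0 < h) (hω : n * h = ω)
    (hg : Function.Periodic g (n : ℤ)) (hd : ∀ i, |g (i + 1) - g i| ≤ h * D)
    (hB : h * ∑ j ∈ Finset.range n, |g j| ≤ B) (i : ℤ) : |g i| ≤ B / ω + ω * D := by
  have hn' : (0 : ℝ) < n := by exact_mod_cast hn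
  have hω0 : 0 < ω := by rw [← hω]; positivity
  obtain ⟨j, hj, hjB⟩ := Finset.exists_le_of_sum_le (s := Finset.range n)
    (f := fun j : ℕ => |g j|) (g := fun _ => B / ω) (Finset.nonempty_range_iff.2 hn.ne') (by
      rw [Finset.sum_const, Finset.card_range, nsmul_eq_mul, ← hω]
      rw [show (n : ℝ) * (B / (n * h)) = B / h by field_simp, le_div_iff₀ hh]
      linarith)
  have hgj : Function.Periodic (fun i : ℤ => g (j + i)) (n : ℤ) := fun i => by
    simpa only [add_assoc] using hg (j + i)
  obtain ⟨l, hl, e2⟩ := hgj.exists_nat_lt hn (i - j)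
  have hD : 0 ≤ h * D := (abs_nonneg _).trans (hd 0)
  simp only [add_sub_cancel] at e2
  have h1 := abs_sub_le_of_increment hd j l
  have h2 : (l : ℝ) * (h * D) ≤ n * (h * D) := by gcongr
  rw [e2]
  have h3 : |g (j + l)| ≤ |g (j + l) - g j| + |g j| := by
    simpa using abs_add_le (g (j + l) - g j) (g j)
  have h4 : (n : ℝ) * (h * D) = ω * D := by rw [← hω]; ring
  linarith

namespace OddPeriodic

variable {n : ℕ} {g f : ℤ → ℝ}

theorem zero : OddPeriodic n 0 := ⟨fun _ => by simp, fun _ => by simp⟩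

theorem add (hg : OddPeriodic n g) (hf : OddPeriodic n f) : OddPeriodic n (g + f) :=
  ⟨fun i => by simp only [Pi.add_apply, hg.odd, hf.odd]; ring, hg.period.add hf.period⟩

theorem smul (s : ℝ) (hg : OddPeriodic n g) : OddPeriodic n (s • g) :=
  ⟨fun i => by simp [hg.odd], fun i => by simp [hg.period i]⟩

theorem apply_zero (hg : OddPeriodic n g) : g 0 = 0 := by
  have := hg.odd 0
  simp only [neg_zero] at this
  linarith

end OddPeriodic

/-- The discrete paths `ψ i + c * i` considered in the minimization. -/
noncomputable def tilt (c : ℝ) (ψ : ℤ → ℝ) (i : ℤ) : ℝ := ψ i + c * i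

theorem exists_min_discreteAction (n : ℕ) (h c R : ℝ) (hR : 0 ≤ R) :
    ∃ x ψ : ℤ → ℝ, OddPeriodic n x ∧ OddPeriodic n ψ ∧ (∀ i, |x i| ≤ R) ∧ (∀ i, |ψ i| ≤ R) ∧
      ∀ x' ψ' : ℤ → ℝ, OddPeriodic n x' → OddPeriodic n ψ' → (∀ i, |x' i| ≤ R) →
        (∀ i, |ψ' i| ≤ R) →
        discreteAction n h x (tilt c ψ) ≤ discreteAction n h x' (tilt c ψ') := by
  let A : Set (ℤ → ℝ) := {x | OddPeriodic n x ∧ ∀ i, |x i| ≤ R}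
  have hA : IsCompact A := by
    have h1 : IsCompact (Set.univ.pi fun _ : ℤ => Set.Icc (-R) R) :=
      isCompact_univ_pi fun _ => isCompact_Icc
    refine h1.of_isClosed_subset ?_ fun x hx i _ => abs_le.1 (hx.2 i)
    have : A = (⋂ i, {x | x (-i) = -x i}) ∩ (⋂ i, {x | x (i + n) = x i}) ∩ ⋂ i, {x | |x i| ≤ R} := by
      ext x
      simp only [A, Set.mem_ofPred_eq, Set.mem_inter_iff, Set.mem_iInter]
      exact ⟨fun hx => ⟨⟨hx.1.1, hx.1.2⟩, hx.2⟩, fun hx => ⟨⟨hx.1.1, hx.1.2⟩, hx.2⟩⟩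
    rw [this]
    refine ((isClosed_iInter fun i => ?_).inter (isClosed_iInter fun i => ?_)).inter
      (isClosed_iInter fun i => ?_)
    · exact isClosed_eq (by fun_prop) (by fun_prop)
    · exact isClosed_eq (by fun_prop) (by fun_prop)
    · exact isClosed_le (by fun_prop) (by fun_prop)
  have hc : Continuous fun p : (ℤ → ℝ) × (ℤ → ℝ) => discreteAction n h p.1 (tilt c p.2) := by
    unfold discreteAction tilt inertia diffQuot
    simp only [div_eq_mul_inv]
    fun_prop
  obtain ⟨p, hp, hmin⟩ := (hA.prod hA).exists_isMinOn
    ⟨(0, 0), by simp [A, OddPeriodic.zero, hR]⟩ hc.continuousOn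
  exact ⟨p.1, p.2, hp.1.1, hp.2.1, hp.1.2, hp.2.2, fun x' ψ' hx hψ hx' hψ' =>
    hmin (a := (x', ψ')) ⟨⟨hx, hx'⟩, ⟨hψ, hψ'⟩⟩⟩

theorem tilt_odd {n : ℕ} {c : ℝ} {ψ : ℤ → ℝ} (hψ : OddPeriodic n ψ) (i : ℤ) :
    tilt c ψ (-i) = -tilt c ψ i := by
  simp only [tilt, hψ.odd, Int.cast_neg]; ring

theorem tilt_add {n : ℕ} {c : ℝ} {ψ : ℤ → ℝ} (hψ : OddPeriodic n ψ) (i : ℤ) :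
    tilt c ψ (i + n) = tilt c ψ i + c * n := by
  have := hψ.period i
  simp only [tilt, this, Int.cast_add, Int.cast_natCast]; ring

theorem diffQuot_tilt {h c : ℝ} (ψ : ℤ → ℝ) (i : ℤ) :
    diffQuot h (tilt c ψ) i = diffQuot h ψ i + c / h := by
  simp only [diffQuot, tilt, Int.cast_add, Int.cast_one]; ring

/-- First variation of the discrete action with respect to `x`. -/
noncomputable def gradX (h : ℝ) (x φ : ℤ → ℝ) (i : ℤ) : ℝ :=
  h / 2 * x i * (diffQuot h φ i ^ 2 + diffQuot h φ (i - 1) ^ 2) + diffQuot h x (i - 1) - diffQuot h x i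
    - h * sin (φ i)

/-- First variation of the discrete action with respect to `φ`. -/
noncomputable def gradφ (h : ℝ) (x φ : ℤ → ℝ) (i : ℤ) : ℝ :=
  inertia x (i - 1) * diffQuot h φ (i - 1) - inertia x i * diffQuot h φ i - h * (x i * cos (φ i))

theorem diffQuot_neg {h : ℝ} {g : ℤ → ℝ} (hg : ∀ i, g (-i) = -g i) (i : ℤ) :
    diffQuot h g (-i) = diffQuot h g (i - 1) := by
  have h1 := hg (i - 1)
  simp only [diffQuot, sub_add_cancel]
  rw [show -i + 1 = -(i - 1) by ring, h1, hg i]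
  ring

theorem diffQuot_add {n : ℕ} {h b : ℝ} {g : ℤ → ℝ} (hg : ∀ i, g (i + n) = g i + b) (i : ℤ) :
    diffQuot h g (i + n) = diffQuot h g i := by
  simp only [diffQuot]
  rw [add_right_comm, hg, hg]
  ring

theorem inertia_neg {n : ℕ} {x : ℤ → ℝ} (hx : OddPeriodic n x) (i : ℤ) :
    inertia x (-i) = inertia x (i - 1) := by
  simp only [inertia, sub_add_cancel]
  rw [show -i + 1 = -(i - 1) by ring, hx.odd, hx.odd]
  ring

theorem inertia_add {n : ℕ} {x : ℤ → ℝ} (hx : OddPeriodic n x) (i : ℤ) :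
    inertia x (i + n) = inertia x i := by
  simp only [inertia]
  rw [add_right_comm, hx.period, hx.period]

section variation

variable {n k : ℕ} {h : ℝ} {x φ : ℤ → ℝ} (hx : OddPeriodic n x)
  (hφn : ∀ i, φ (i + n) = φ i + 2 * π * k)

include hx hφn

theorem oddPeriodic_gradX (hφ : ∀ i, φ (-i) = -φ i) : OddPeriodic n (gradX h x φ) := by
  have hxn : ∀ i, x (i + n) = x i + 0 := fun i => by rw [hx.period, add_zero]
  constructor
  · intro i
    have h1 := diffQuot_neg (h := h) hφ (i + 1)
    have h2 := diffQuot_neg (h := h) hx.odd (i + 1)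
    rw [neg_add, ← sub_eq_add_neg, add_sub_cancel_right] at h1 h2
    simp only [gradX, hx.odd, hφ, sin_neg, h1, h2, diffQuot_neg hφ, diffQuot_neg hx.odd]
    ring
  · intro i
    simp only [gradX]
    rw [add_sub_right_comm i, diffQuot_add hφn, diffQuot_add hφn, diffQuot_add hxn, diffQuot_add hxn,
      hx.period, hφn, mul_comm (2 * π), sin_add_nat_mul_two_pi]

theorem oddPeriodic_gradφ (hφ : ∀ i, φ (-i) = -φ i) : OddPeriodic n (gradφ h x φ) := by
  constructor
  · intro i
    have h1 := diffQuot_neg (h := h) hφ (i + 1)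
    have h2 := inertia_neg hx (i + 1)
    rw [neg_add, ← sub_eq_add_neg, add_sub_cancel_right] at h1 h2
    simp only [gradφ, hx.odd, hφ, cos_neg, h1, h2, diffQuot_neg hφ, inertia_neg hx]
    ring
  · intro i
    simp only [gradφ]
    rw [add_sub_right_comm i, diffQuot_add hφn, diffQuot_add hφn, inertia_add hx, inertia_add hx,
      hx.period, hφn, mul_comm (2 * π), cos_add_nat_mul_two_pi]

theorem hasDerivAt_discreteAction_x (hh : h ≠ 0) {η : ℤ → ℝ} (hη : OddPeriodic n η) :
    HasDerivAt (fun s : ℝ => discreteAction n h (x + s • η) φ)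
      (∑ i ∈ Finset.range n, η i * gradX h x φ i) 0 := by
  have hxn : ∀ i, x (i + n) = x i + 0 := fun i => by rw [hx.period, add_zero]
  have hd : HasDerivAt (fun s : ℝ => discreteAction n h (x + s • η) φ)
      (∑ i ∈ Finset.range n, (η i * (h / 2 * x i * diffQuot h φ i ^ 2 - diffQuot h x i - h * sin (φ i))
        + η (i + 1) * (h / 2 * x (i + 1) * diffQuot h φ i ^ 2 + diffQuot h x i))) 0 := by
    unfold discreteAction
    refine HasDerivAt.fun_sum fun i _ => ?_
    have l : ∀ j : ℤ, HasDerivAt (fun s : ℝ => (x + s • η) j) (η j) 0 := fun j => by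
      simpa using ((hasDerivAt_id (0 : ℝ)).mul_const (η j)).const_add (x j)
    have l0 := l i
    have l1 := l (i + 1)
    have := ((((((l0.pow 2).add (l1.pow 2)).div_const 2).add_const 1).const_mul (1 / 2)).mul_const
      (diffQuot h φ i ^ 2) |>.add ((((l1.sub l0).div_const h).pow 2).const_mul (1 / 2)) |>.sub
      (l0.mul_const (sin (φ i)))).const_mul h
    refine HasDerivAt.congr_deriv this ?_
    simp [diffQuot]
    field_simp
    ring
  convert hd using 1
  rw [Finset.sum_add_distrib]
  have hp : Function.Periodic (fun i : ℤ => η i * (h / 2 * x i * diffQuot h φ (i - 1) ^ 2 +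
      diffQuot h x (i - 1))) (n : ℤ) := fun i => by
    simp only
    rw [add_sub_right_comm i, diffQuot_add hφn, diffQuot_add hxn, hη.period, hx.period]
  have := hp.sum_range_add_one
  simp only [add_sub_cancel_right] at this
  rw [this, ← Finset.sum_add_distrib]
  refine Finset.sum_congr rfl fun i _ => ?_
  simp only [gradX]
  ring

theorem hasDerivAt_discreteAction_φ (hh : h ≠ 0) {η : ℤ → ℝ} (hη : OddPeriodic n η) :
    HasDerivAt (fun s : ℝ => discreteAction n h x (φ + s • η))
      (∑ i ∈ Finset.range n, η i * gradφ h x φ i) 0 := by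
  have hd : HasDerivAt (fun s : ℝ => discreteAction n h x (φ + s • η))
      (∑ i ∈ Finset.range n, (η i * (-(inertia x i * diffQuot h φ i) - h * (x i * cos (φ i)))
        + η (i + 1) * (inertia x i * diffQuot h φ i))) 0 := by
    unfold discreteAction
    refine HasDerivAt.fun_sum fun i _ => ?_
    have l : ∀ j : ℤ, HasDerivAt (fun s : ℝ => (φ + s • η) j) (η j) 0 := fun j => by
      simpa using ((hasDerivAt_id (0 : ℝ)).mul_const (η j)).const_add (φ j)
    have l0 := l i
    have l1 := l (i + 1)
    have := ((((((l1.sub l0).div_const h).pow 2).const_mul (1 / 2 * inertia x i)).add_const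
      (1 / 2 * diffQuot h x i ^ 2)).sub (l0.sin.const_mul (x i))).const_mul h
    refine HasDerivAt.congr_deriv this ?_
    simp [diffQuot]
    field_simp
    ring
  convert hd using 1
  rw [Finset.sum_add_distrib]
  have hp : Function.Periodic (fun i : ℤ => η i * (inertia x (i - 1) * diffQuot h φ (i - 1)))
      (n : ℤ) := fun i => by
    simp only
    rw [add_sub_right_comm i, diffQuot_add hφn, inertia_add hx, hη.period]
  have := hp.sum_range_add_one
  simp only [add_sub_cancel_right] at this
  rw [this, ← Finset.sum_add_distrib]
  refine Finset.sum_congr rfl fun i _ => ?_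
  simp only [gradφ]
  ring

end variation

theorem OddPeriodic.eq_zero_of_sum_sq {n : ℕ} (hn : 0 < n) {g : ℤ → ℝ} (hg : OddPeriodic n g)
    (h : ∑ i ∈ Finset.range n, g i * g i = 0) (i : ℤ) : g i = 0 := by
  rw [Finset.sum_eq_zero_iff_of_nonneg fun _ _ => mul_self_nonneg _] at h
  obtain ⟨j, hj, e⟩ := hg.period.exists_nat_lt hn i
  rw [e]
  exact mul_self_eq_zero.1 (h j (Finset.mem_range.2 hj))

theorem OddPeriodic.eventually_abs_le {n : ℕ} (hn : 0 < n) {x η : ℤ → ℝ} {R : ℝ}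
    (hη : OddPeriodic n η) (hx : ∀ i, |x i| ≤ R) :
    ∀ᶠ s : ℝ in nhds 0, ∀ i, |(x + s • η) i| ≤ R + 1 := by
  have hc : Filter.Tendsto (fun s : ℝ => |s| * ∑ j ∈ Finset.range n, |η j|) (nhds 0) (nhds 0) := by
    have : Continuous fun s : ℝ => |s| * ∑ j ∈ Finset.range n, |η j| := by fun_prop
    simpa using this.tendsto 0
  filter_upwards [hc.eventually_le_const one_pos] with s hs i
  have h1 := abs_add_le (x i) (s * η i)
  rw [abs_mul] at h1
  have h2 := mul_le_mul_of_nonneg_left (hη.period.abs_le_sum hn i) (abs_nonneg s)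
  simp only [Pi.add_apply, Pi.smul_apply, smul_eq_mul]
  linarith [hx i]

/-- An interior minimizer of the discrete action solves the discrete Lagrange equations. -/
theorem grad_eq_zero {n k : ℕ} (hn : 0 < n) {h c R : ℝ} (hh : h ≠ 0) (hc : c * n = 2 * π * k)
    {x ψ : ℤ → ℝ} (hx : OddPeriodic n x) (hψ : OddPeriodic n ψ) (hxR : ∀ i, |x i| ≤ R)
    (hψR : ∀ i, |ψ i| ≤ R)
    (hmin : ∀ x' ψ' : ℤ → ℝ, OddPeriodic n x' → OddPeriodic n ψ' → (∀ i, |x' i| ≤ R + 1) →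
        (∀ i, |ψ' i| ≤ R + 1) →
        discreteAction n h x (tilt c ψ) ≤ discreteAction n h x' (tilt c ψ')) (i : ℤ) :
    gradX h x (tilt c ψ) i = 0 ∧ gradφ h x (tilt c ψ) i = 0 := by
  have hφ := tilt_odd (c := c) hψ
  have hφn : ∀ i, tilt c ψ (i + n) = tilt c ψ i + 2 * π * k := fun i => hc ▸ tilt_add hψ i
  have hR : ∀ {g : ℤ → ℝ}, (∀ i, |g i| ≤ R) → ∀ i, |g i| ≤ R + 1 := fun hg i => by
    linarith [hg i]
  constructor
  · have hE := oddPeriodic_gradX (h := h) hx hφn hφ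
    refine hE.eq_zero_of_sum_sq hn ?_ i
    refine IsLocalMin.hasDerivAt_eq_zero ?_ (hasDerivAt_discreteAction_x hx hφn hh hE)
    filter_upwards [hE.eventually_abs_le hn hxR] with s hs
    simpa using hmin _ ψ (hx.add (hE.smul s)) hψ hs (hR hψR)
  · have hE := oddPeriodic_gradφ (h := h) hx hφn hφ
    refine hE.eq_zero_of_sum_sq hn ?_ i
    refine IsLocalMin.hasDerivAt_eq_zero ?_ (hasDerivAt_discreteAction_φ hx hφn hh hE)
    filter_upwards [hE.eventually_abs_le hn hψR] with s hs
    have e : tilt c ψ + s • gradφ h x (tilt c ψ) = tilt c (ψ + s • gradφ h x (tilt c ψ)) := by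
      funext i
      simp only [tilt, Pi.add_apply]
      ring
    rw [e]
    simpa using hmin x _ hx (hψ.add (hE.smul s)) (hR hxR) hs

theorem OddPeriodic.abs_le_sum_diffQuot {n : ℕ} (hn : 0 < n) {h : ℝ} (hh : 0 < h) {g : ℤ → ℝ}
    (hg : OddPeriodic n g) (i : ℤ) :
    |g i| ≤ h * ∑ j ∈ Finset.range n, |diffQuot h g j| := by
  obtain ⟨m, hm, e⟩ := hg.period.exists_nat_lt hn i
  have h1 := Finset.sum_range_sub (fun i : ℕ => g i) m
  simp only [Nat.cast_zero, hg.apply_zero, sub_zero] at h1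
  rw [e, ← h1, Finset.mul_sum]
  refine (Finset.abs_sum_le_sum_abs _ _).trans ?_
  refine (Finset.sum_le_sum_of_subset_of_nonneg (Finset.range_mono hm.le)
    fun _ _ _ => abs_nonneg _).trans (Finset.sum_le_sum fun j _ => ?_)
  rw [diffQuot, abs_div, abs_of_pos hh, mul_div_cancel₀ _ hh.ne', Nat.cast_add, Nat.cast_one]

theorem one_le_inertia (x : ℤ → ℝ) (i : ℤ) : 1 ≤ inertia x i := by
  unfold inertia
  nlinarith [sq_nonneg (x i), sq_nonneg (x (i + 1))]

theorem inertia_le {x : ℤ → ℝ} {M : ℝ} (hx : ∀ i, |x i| ≤ M) (i : ℤ) : inertia x i ≤ M ^ 2 + 1 := by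
  unfold inertia
  have h1 := sq_le_sq' (abs_le.1 (hx i)).1 (abs_le.1 (hx i)).2
  have h2 := sq_le_sq' (abs_le.1 (hx (i + 1))).1 (abs_le.1 (hx (i + 1))).2
  linarith

/-- Paths whose action does not exceed that of the uniform rotation obey uniform bounds. -/
theorem exists_energy_bound {ω w : ℝ} (hω : 0 < ω) (hw : 0 ≤ w) : ∃ M : ℝ, 0 ≤ M ∧
    ∀ (n : ℕ) (h : ℝ), 0 < n → 0 < h → n * h = ω → ∀ x ψ : ℤ → ℝ, OddPeriodic n x →
      OddPeriodic n ψ →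
      discreteAction n h x (tilt (h * w) ψ) ≤ discreteAction n h 0 (tilt (h * w) 0) →
      (∀ i, |x i| ≤ M) ∧ (∀ i, |ψ i| ≤ M) ∧
        h * ∑ i ∈ Finset.range n, |diffQuot h x i| ≤ M ∧
        h * ∑ i ∈ Finset.range n, |diffQuot h (tilt (h * w) ψ) i| ≤ M := by
  set C := ω / 2 * w ^ 2 with hC
  have hC0 : 0 ≤ C := by positivity
  set M₁ := 2 * ω ^ 2 + 2 * ω * C + 1 with hM₁
  have hM₁0 : 1 ≤ M₁ := by
    have : 0 ≤ 2 * ω ^ 2 + 2 * ω * C := by positivity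
    linarith
  set V := (ω + 2 * (C + ω * M₁)) / 2 with hV
  have hV0 : 0 ≤ V := by positivity
  have hωw : 0 ≤ ω * w := by positivity
  refine ⟨M₁ + V + ω * w, by positivity, fun n h hn hh hnh x ψ hx hψ hact => ?_⟩
  have hn' : (0 : ℝ) < n := by exact_mod_cast hn
  set φ := tilt (h * w) ψ with hφ
  set A := h * ∑ i ∈ Finset.range n, |diffQuot h x i| with hA
  set U := h * ∑ i ∈ Finset.range n, diffQuot h x i ^ 2 with hU
  set B := h * ∑ i ∈ Finset.range n, diffQuot h φ i ^ 2 with hB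
  have hB0 : 0 ≤ B := mul_nonneg hh.le (Finset.sum_nonneg fun _ _ => sq_nonneg _)
  have hxA : ∀ i, |x i| ≤ A := hx.abs_le_sum_diffQuot hn hh
  have hA0 : 0 ≤ A := (abs_nonneg _).trans (hxA 0)
  have hAU : A ^ 2 ≤ ω * U := by
    have := sq_sum_le_card_mul_sum_sq (s := Finset.range n) (f := fun i : ℕ => |diffQuot h x i|)
    simp only [sq_abs, Finset.card_range] at this
    calc A ^ 2 = h ^ 2 * (∑ i ∈ Finset.range n, |diffQuot h x i|) ^ 2 := by rw [hA]; ring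
      _ ≤ h ^ 2 * (n * ∑ i ∈ Finset.range n, diffQuot h x i ^ 2) := by gcongr
      _ = ω * U := by rw [hU, ← hnh]; ring
  have h0 : discreteAction n h 0 (tilt (h * w) 0) = C := by
    have : ∀ i, diffQuot h (tilt (h * w) 0) i = w := fun i => by
      rw [diffQuot_tilt]
      simp [diffQuot, hh.ne']
    simp only [discreteAction, this]
    simp [inertia, diffQuot, hC, ← hnh]
    ring
  have hlow : 1 / 2 * B + 1 / 2 * U - ω * A ≤ C := by
    rw [h0] at hact
    refine le_trans ?_ hact
    have : 1 / 2 * B + 1 / 2 * U - ω * A = ∑ i ∈ Finset.range n,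
        h * (1 / 2 * diffQuot h φ i ^ 2 + 1 / 2 * diffQuot h x i ^ 2 - A) := by
      rw [← Finset.mul_sum, Finset.sum_sub_distrib, Finset.sum_add_distrib, ← Finset.mul_sum,
        ← Finset.mul_sum, Finset.sum_const, Finset.card_range, nsmul_eq_mul, ← hnh, hB, hU]
      ring
    rw [this, discreteAction]
    refine Finset.sum_le_sum fun i _ => mul_le_mul_of_nonneg_left ?_ hh.le
    have h1 : x i * sin (φ i) ≤ A := by
      refine (le_abs_self _).trans ?_
      rw [abs_mul]
      exact (mul_le_of_le_one_right (abs_nonneg _) (abs_sin_le_one _)).trans (hxA i)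
    have h2 := mul_le_mul_of_nonneg_right (one_le_inertia x i) (sq_nonneg (diffQuot h φ i))
    linarith
  have hAM : A ≤ M₁ := by
    by_contra! hlt
    have h1 : A ^ 2 ≤ 2 * ω * C + 2 * ω ^ 2 * A := by nlinarith
    have h2 : M₁ * A < A * A := mul_lt_mul_of_pos_right hlt (by linarith)
    have h3 : 2 * ω * C ≤ 2 * ω * C * A := le_mul_of_one_le_right (by positivity) (by linarith)
    nlinarith
  have hBM : B ≤ 2 * (C + ω * M₁) := by
    have h1 : 0 ≤ U := mul_nonneg hh.le (Finset.sum_nonneg fun _ _ => sq_nonneg _)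
    have h2 : ω * A ≤ ω * M₁ := by gcongr
    linarith
  have hVv : h * ∑ i ∈ Finset.range n, |diffQuot h φ i| ≤ V := by
    have : h * ∑ i ∈ Finset.range n, |diffQuot h φ i| ≤
        h * ∑ i ∈ Finset.range n, (1 + diffQuot h φ i ^ 2) / 2 := by
      refine mul_le_mul_of_nonneg_left (Finset.sum_le_sum fun i _ => ?_) hh.le
      rw [← sq_abs (diffQuot h φ i)]
      nlinarith [sq_nonneg (|diffQuot h φ i| - 1)]
    rw [← Finset.sum_div, Finset.sum_add_distrib, Finset.sum_const, Finset.card_range,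
      nsmul_eq_mul, mul_one] at this
    have e : h * ((n + ∑ i ∈ Finset.range n, diffQuot h φ i ^ 2) / 2) = (ω + B) / 2 := by
      rw [← hnh, hB]; ring
    rw [e] at this
    linarith
  refine ⟨fun i => by linarith [hxA i], fun i => ?_, by linarith, by linarith⟩
  have h1 := hψ.abs_le_sum_diffQuot hn hh i
  have h2 : h * ∑ j ∈ Finset.range n, |diffQuot h ψ j| ≤
      h * ∑ j ∈ Finset.range n, (|diffQuot h φ j| + w) := by
    refine mul_le_mul_of_nonneg_left (Finset.sum_le_sum fun j _ => ?_) hh.le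
    have e : diffQuot h ψ j = diffQuot h φ j - w := by
      rw [hφ, diffQuot_tilt, mul_div_cancel_left₀ _ hh.ne', add_sub_cancel_right]
    rw [e]
    exact (abs_sub _ _).trans_eq (by rw [abs_of_nonneg hw])
  rw [Finset.sum_add_distrib, Finset.sum_const, Finset.card_range, nsmul_eq_mul, mul_add] at h2
  have e : h * (n * w) = ω * w := by rw [← hnh]; ring
  linarith

/-- The discrete Lagrange equations have odd, quasi-periodic solutions bounded independently of
the step. -/
theorem exists_discrete_solution {ω : ℝ} (hω : 0 < ω) (k : ℕ) : ∃ C : ℝ, ∀ n : ℕ, 0 < n →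
    ∃ x φ : ℤ → ℝ, OddPeriodic n x ∧ (∀ i, φ (-i) = -φ i) ∧ (∀ i, φ (i + n) = φ i + 2 * π * k) ∧
      (∀ i, gradX (ω / n) x φ i = 0) ∧ (∀ i, gradφ (ω / n) x φ i = 0) ∧ (∀ i, |x i| ≤ C) ∧
      (∀ i, |diffQuot (ω / n) x i| ≤ C) ∧ ∀ i, |diffQuot (ω / n) φ i| ≤ C := by
  set w := 2 * π * k / ω with hw
  obtain ⟨M, hM0, hM⟩ := exists_energy_bound hω (w := w) (by positivity)
  set Q := (M ^ 2 + 1) * M / ω + ω * M with hQ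
  have hQ0 : 0 ≤ Q := by positivity
  set U := M / ω + ω * (M * Q ^ 2 + 1) with hU
  have hU0 : 0 ≤ U := by positivity
  refine ⟨M + Q + U, fun n hn => ?_⟩
  have hn' : (0 : ℝ) < n := by exact_mod_cast hn
  set h := ω / n with hh_def
  have hh : 0 < h := by positivity
  have hnh : n * h = ω := by rw [hh_def]; field_simp
  have hc : h * w * n = 2 * π * k := by
    rw [mul_right_comm, mul_comm h, hnh, hw]; field_simp
  obtain ⟨x, ψ, hx, hψ, -, -, hmin⟩ :=
    exists_min_discreteAction n h (h * w) (M + 1) (by positivity)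
  obtain ⟨hxM, hψM, hu, hv⟩ := hM n h hn hh hnh x ψ hx hψ
    (hmin 0 0 .zero .zero (by simp; positivity) (by simp; positivity))
  have hgrad := grad_eq_zero hn hh.ne' hc hx hψ hxM hψM hmin
  set φ := tilt (h * w) ψ with hφ
  have hφn : ∀ i, φ (i + n) = φ i + 2 * π * k := fun i => hc ▸ tilt_add hψ i
  have hxn : ∀ i, x (i + n) = x i + 0 := fun i => by rw [hx.period, add_zero]
  have hq : ∀ i, |inertia x i * diffQuot h φ i| ≤ Q := by
    refine Function.Periodic.abs_le_of_increment hn (g := fun i => inertia x i * diffQuot h φ i)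
      hh hnh (fun i => ?_) (fun i => ?_) ?_
    · simp only [inertia_add hx, diffQuot_add hφn]
    · have := (hgrad (i + 1)).2
      rw [gradφ, add_sub_cancel_right] at this
      have e : inertia x (i + 1) * diffQuot h φ (i + 1) - inertia x i * diffQuot h φ i
        = -(h * (x (i + 1) * cos (φ (i + 1)))) := by linarith
      rw [e, abs_neg, abs_mul, abs_mul, abs_of_pos hh]
      refine mul_le_mul_of_nonneg_left ?_ hh.le
      exact (mul_le_of_le_one_right (abs_nonneg _) (abs_cos_le_one _)).trans (hxM _)
    · calc h * ∑ j ∈ Finset.range n, |inertia x j * diffQuot h φ j|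
          ≤ h * ∑ j ∈ Finset.range n, (M ^ 2 + 1) * |diffQuot h φ j| := by
            refine mul_le_mul_of_nonneg_left (Finset.sum_le_sum fun j _ => ?_) hh.le
            rw [abs_mul, abs_of_nonneg (zero_le_one.trans (one_le_inertia x j))]
            exact mul_le_mul_of_nonneg_right (inertia_le hxM j) (abs_nonneg _)
        _ = (M ^ 2 + 1) * (h * ∑ j ∈ Finset.range n, |diffQuot h φ j|) := by
            rw [← Finset.mul_sum]; ring
        _ ≤ (M ^ 2 + 1) * M := by gcongr
  have hvQ : ∀ i, |diffQuot h φ i| ≤ Q := fun i => by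
    refine le_trans ?_ (hq i)
    rw [abs_mul, abs_of_nonneg (zero_le_one.trans (one_le_inertia x i))]
    exact le_mul_of_one_le_left (abs_nonneg _) (one_le_inertia x i)
  have huU : ∀ i, |diffQuot h x i| ≤ U := by
    refine Function.Periodic.abs_le_of_increment hn hh hnh (fun i => diffQuot_add hxn i)
      (fun i => ?_) hu
    have := (hgrad (i + 1)).1
    rw [gradX, add_sub_cancel_right] at this
    have e : diffQuot h x (i + 1) - diffQuot h x i = h * (x (i + 1) *
        ((diffQuot h φ (i + 1) ^ 2 + diffQuot h φ i ^ 2) / 2) - sin (φ (i + 1))) := by linarith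
    rw [e, abs_mul, abs_of_pos hh]
    refine mul_le_mul_of_nonneg_left ?_ hh.le
    refine (abs_sub _ _).trans (add_le_add ?_ (abs_sin_le_one _))
    rw [abs_mul]
    refine mul_le_mul (hxM _) ?_ (abs_nonneg _) hM0
    rw [abs_of_nonneg (by positivity)]
    have h1 := sq_le_sq' (abs_le.1 (hvQ i)).1 (abs_le.1 (hvQ i)).2
    have h2 := sq_le_sq' (abs_le.1 (hvQ (i + 1))).1 (abs_le.1 (hvQ (i + 1))).2
    linarith
  exact ⟨x, φ, hx, tilt_odd hψ, hφn, fun i => (hgrad i).1, fun i => (hgrad i).2,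
    fun i => by linarith [hxM i], fun i => by linarith [huU i], fun i => by linarith [hvQ i]⟩

open Filter Topology

/-- A family of sequences that is uniformly bounded and uniformly Lipschitz on the grids of
step `h m`. -/
structure Tame (h : ℕ → ℝ) (g : ℕ → ℤ → ℝ) : Prop where
  bdd : ∃ C, ∀ m i, |g m i| ≤ C
  lip : ∃ C, ∀ m i, |g m (i + 1) - g m i| ≤ C * h m

namespace Tame

variable {h : ℕ → ℝ} {f g : ℕ → ℤ → ℝ}

theorem const (c : ℝ) : Tame h (fun _ _ => c) :=
  ⟨⟨|c|, fun _ _ => le_rfl⟩, ⟨0, fun m i => by simp⟩⟩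

theorem add (hf : Tame h f) (hg : Tame h g) : Tame h (fun m i => f m i + g m i) := by
  obtain ⟨⟨A, hA⟩, ⟨A', hA'⟩⟩ := hf
  obtain ⟨⟨B, hB⟩, ⟨B', hB'⟩⟩ := hg
  refine ⟨⟨A + B, fun m i => (abs_add_le _ _).trans (add_le_add (hA m i) (hB m i))⟩,
    ⟨A' + B', fun m i => ?_⟩⟩
  rw [add_sub_add_comm, add_mul]
  exact (abs_add_le _ _).trans (add_le_add (hA' m i) (hB' m i))

theorem mul (hf : Tame h f) (hg : Tame h g) : Tame h (fun m i => f m i * g m i) := by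
  obtain ⟨⟨A, hA⟩, ⟨A', hA'⟩⟩ := hf
  obtain ⟨⟨B, hB⟩, ⟨B', hB'⟩⟩ := hg
  have hA0 : 0 ≤ A := (abs_nonneg _).trans (hA 0 0)
  refine ⟨⟨A * B, fun m i => ?_⟩, ⟨A * B' + A' * B, fun m i => ?_⟩⟩
  · rw [abs_mul]
    exact mul_le_mul (hA m i) (hB m i) (abs_nonneg _) hA0
  · have e : f m (i + 1) * g m (i + 1) - f m i * g m i =
        f m (i + 1) * (g m (i + 1) - g m i) + (f m (i + 1) - f m i) * g m i := by ring
    rw [e]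
    refine (abs_add_le _ _).trans ?_
    rw [abs_mul, abs_mul]
    have h1 := mul_le_mul (hA m (i + 1)) (hB' m i) (abs_nonneg _) hA0
    have h2 := mul_le_mul (hA' m i) (hB m i) (abs_nonneg _) ((abs_nonneg _).trans (hA' m i))
    linarith

theorem const_mul (c : ℝ) (hg : Tame h g) : Tame h (fun m i => c * g m i) :=
  (const c).mul hg

theorem shift (hg : Tame h g) : Tame h (fun m i => g m (i + 1)) :=
  ⟨hg.bdd.imp fun _ hC m i => hC m (i + 1), hg.lip.imp fun _ hC m i => hC m (i + 1)⟩

theorem inv (hg : Tame h g) (h1 : ∀ m i, 1 ≤ g m i) : Tame h (fun m i => (g m i)⁻¹) := by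
  obtain ⟨C, hC⟩ := hg.lip
  refine ⟨⟨1, fun m i => ?_⟩, ⟨C, fun m i => ?_⟩⟩
  · rw [abs_of_nonneg (inv_nonneg.2 (zero_le_one.trans (h1 m i)))]
    exact inv_le_one_of_one_le₀ (h1 m i)
  · have a := zero_lt_one.trans_le (h1 m i)
    have b := zero_lt_one.trans_le (h1 m (i + 1))
    rw [inv_sub_inv b.ne' a.ne', abs_div, abs_sub_comm, abs_of_pos (mul_pos b a)]
    exact (div_le_self (abs_nonneg _)
      (one_le_mul_of_one_le_of_one_le (h1 m (i + 1)) (h1 m i))).trans (hC m i)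

theorem of_sub_eq (hh : ∀ m, 0 < h m) (hf : ∃ C, ∀ m i, |f m i| ≤ C) (hg : ∃ C, ∀ m i, |g m i| ≤ C)
    (hgf : ∀ m i, g m (i + 1) - g m i = h m * f m i) : Tame h g := by
  refine ⟨hg, hf.imp fun C hC m i => ?_⟩
  rw [hgf, abs_mul, abs_of_pos (hh m), mul_comm]
  exact mul_le_mul_of_nonneg_right (hC m i) (hh m).le

theorem sin_comp (hg : ∃ C, ∀ m i, |g m (i + 1) - g m i| ≤ C * h m) :
    Tame h (fun m i => sin (g m i)) :=
  ⟨⟨1, fun _ _ => abs_sin_le_one _⟩, hg.imp fun _ hC m i =>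
    (abs_sin_sub_sin_le _ _).trans (hC m i)⟩

theorem cos_comp (hg : ∃ C, ∀ m i, |g m (i + 1) - g m i| ≤ C * h m) :
    Tame h (fun m i => cos (g m i)) :=
  ⟨⟨1, fun _ _ => abs_cos_le_one _⟩, hg.imp fun _ hC m i =>
    (abs_cos_sub_cos_le _ _).trans (hC m i)⟩

end Tame

/-- `G` is the limit, along the hyperfilter, of the step functions with values `g m` on the grid
of step `h m`. -/
def IsGridLimit (h : ℕ → ℝ) (g : ℕ → ℤ → ℝ) (G : ℝ → ℝ) : Prop :=
  ∀ t, Tendsto (fun m => g m ⌊t / h m⌋) (hyperfilter ℕ) (𝓝 (G t))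

theorem exists_isGridLimit {h : ℕ → ℝ} {g : ℕ → ℤ → ℝ}
    (hg : ∀ t : ℝ, ∃ C, ∀ m, |g m ⌊t / h m⌋| ≤ C) : ∃ G, IsGridLimit h g G := by
  suffices H : ∀ t, ∃ y, Tendsto (fun m => g m ⌊t / h m⌋) (hyperfilter ℕ) (𝓝 y) by
    choose G hG using H
    exact ⟨G, hG⟩
  intro t
  obtain ⟨C, hC⟩ := hg t
  obtain ⟨y, -, hy⟩ := (isCompact_Icc (a := -C) (b := C)).ultrafilter_le_nhds
    ((hyperfilter ℕ).map fun m => g m ⌊t / h m⌋)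
    (tendsto_principal.2 (Eventually.of_forall fun m => abs_le.1 (hC m)))
  exact ⟨y, hy⟩

theorem abs_sub_le_of_increment_int {g : ℤ → ℝ} {d : ℝ} (hd : ∀ i, |g (i + 1) - g i| ≤ d)
    (i j : ℤ) : |g j - g i| ≤ |(j : ℝ) - i| * d := by
  wlog hij : i ≤ j generalizing i j
  · rw [abs_sub_comm, abs_sub_comm (j : ℝ)]
    exact this j i (le_of_not_ge hij)
  · obtain ⟨m, rfl⟩ := Int.le.dest hij
    simpa using abs_sub_le_of_increment hd i m

/-- Second-order accuracy of the first-order Taylor expansion on a grid. -/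
theorem abs_taylor_le {f g : ℤ → ℝ} {h C : ℝ} (hh : 0 < h) (hC : 0 ≤ C)
    (hf : ∀ i, |f (i + 1) - f i| ≤ C * h)
    (hgf : ∀ i, g (i + 1) - g i = h * f i) (i j : ℤ) :
    |g j - g i - ((j - i : ℝ) * h) * f i| ≤ 2 * C * ((j - i : ℝ) * h) ^ 2 := by
  have up : ∀ (i : ℤ) (m : ℕ), |g (i + m) - g i - (m * h) * f i| ≤ C * (m * h) ^ 2 := by
    intro i m
    induction m with
    | zero => simp
    | succ m ih =>
      have h1 := abs_sub_le_of_increment hf i m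
      have h2 := hgf (i + m)
      have e : g (i + (m + 1 : ℕ)) - g i - (((m + 1 : ℕ) : ℝ) * h) * f i =
          (g (i + m) - g i - (m * h) * f i) + h * (f (i + m) - f i) := by
        have : i + ((m + 1 : ℕ) : ℤ) = i + m + 1 := by push_cast; ring
        rw [this]
        push_cast
        linarith
      rw [e]
      refine (abs_add_le _ _).trans ?_
      rw [abs_mul, abs_of_pos hh]
      have h3 := mul_le_mul_of_nonneg_left h1 hh.le
      have h4 : 0 ≤ C * h ^ 2 * (m + 1) := by positivity
      push_cast
      nlinarith
  rcases le_total i j with hij | hij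
  · obtain ⟨m, rfl⟩ := Int.le.dest hij
    have := up i m
    have h0 : 0 ≤ C * (m * h) ^ 2 := by positivity
    push_cast
    rw [add_sub_cancel_left]
    linarith
  · obtain ⟨m, rfl⟩ := Int.le.dest hij
    have h1 := up j m
    have h2 := abs_sub_le_of_increment hf j m
    have e : g j - g (j + m) - ((j - ((j + m : ℤ) : ℝ)) * h) * f (j + m) =
      -(g (j + m) - g j - (m * h) * f j) + m * h * (f (j + m) - f j) := by push_cast; ring
    rw [e]
    refine (abs_add_le _ _).trans ?_
    rw [abs_neg, abs_mul, abs_of_nonneg (by positivity : 0 ≤ m * h)]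
    have h3 := mul_le_mul_of_nonneg_left h2 (by positivity : 0 ≤ m * h)
    push_cast
    linarith

theorem hasDerivAt_of_abs_le_sq {G : ℝ → ℝ} {s d C : ℝ}
    (H : ∀ t, |G t - G s - (t - s) * d| ≤ C * (t - s) ^ 2) : HasDerivAt G d s := by
  rw [hasDerivAt_iff_isLittleO]
  have h1 : (fun t => G t - G s - (t - s) • d) =O[𝓝 s] fun t => (t - s) ^ 2 := by
    refine Asymptotics.IsBigO.of_bound C (Eventually.of_forall fun t => ?_)
    simpa using H t
  refine h1.trans_isLittleO ?_
  have h2 : (fun x : ℝ => x ^ 2) =o[𝓝 0] fun x => x := Asymptotics.isLittleO_pow_id one_lt_two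
  have h3 : Tendsto (fun t => t - s) (𝓝 s) (𝓝 0) := by
    have : Continuous fun t => t - s := by fun_prop
    simpa using this.tendsto s
  exact h2.comp_tendsto h3

theorem abs_floor_mul_sub_le {h t : ℝ} (hh : 0 < h) : |⌊t / h⌋ * h - t| ≤ h := by
  have h1 := mul_le_mul_of_nonneg_right (Int.floor_le (t / h)) hh.le
  have h2 := mul_le_mul_of_nonneg_right (Int.lt_floor_add_one (t / h)).le hh.le
  rw [div_mul_cancel₀ _ hh.ne'] at h1 h2
  rw [abs_le]
  constructor <;> linarith

theorem tendsto_floor_mul {h : ℕ → ℝ} (hh : ∀ m, 0 < h m) (h0 : Tendsto h atTop (𝓝 0)) (t : ℝ) :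
    Tendsto (fun m => (⌊t / h m⌋ : ℝ) * h m) (hyperfilter ℕ) (𝓝 t) := by
  rw [tendsto_iff_norm_sub_tendsto_zero]
  exact squeeze_zero (fun _ => norm_nonneg _) (fun m => abs_floor_mul_sub_le (hh m))
    (h0.mono_left Nat.hyperfilter_le_atTop)

namespace IsGridLimit

variable {h : ℕ → ℝ} {f g : ℕ → ℤ → ℝ} {F G : ℝ → ℝ}

theorem comp_near (h0 : Tendsto h atTop (𝓝 0)) (hg : ∃ C, ∀ m i, |g m (i + 1) - g m i| ≤ C * h m)
    (hG : IsGridLimit h g G) {t : ℝ} {j : ℕ → ℤ}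
    (hj : ∀ m, |(j m : ℝ) - ⌊t / h m⌋| ≤ 1) :
    Tendsto (fun m => g m (j m)) (hyperfilter ℕ) (𝓝 (G t)) := by
  obtain ⟨C, hC⟩ := hg
  have hz : Tendsto (fun m => g m (j m) - g m ⌊t / h m⌋) (hyperfilter ℕ) (𝓝 0) := by
    refine squeeze_zero_norm (a := fun m => C * h m) (fun m => ?_) ?_
    · refine (abs_sub_le_of_increment_int (hC m) _ _).trans ?_
      exact mul_le_of_le_one_left ((abs_nonneg _).trans (hC m 0)) (hj m)
    · simpa using (h0.mono_left Nat.hyperfilter_le_atTop).const_mul C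
  simpa using hz.add (hG t)

theorem shift (h0 : Tendsto h atTop (𝓝 0)) (hg : ∃ C, ∀ m i, |g m (i + 1) - g m i| ≤ C * h m)
    (hG : IsGridLimit h g G) : IsGridLimit h (fun m i => g m (i + 1)) G := fun t =>
  comp_near (j := fun m => ⌊t / h m⌋ + 1) h0 hg hG fun m => by simp

theorem odd (h0 : Tendsto h atTop (𝓝 0)) (hg : ∃ C, ∀ m i, |g m (i + 1) - g m i| ≤ C * h m)
    (hG : IsGridLimit h g G) (hodd : ∀ m i, g m (-i) = -g m i) (t : ℝ) : G t = -G (-t) := by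
  have h1 : Tendsto (fun m => g m (-⌊-t / h m⌋)) (hyperfilter ℕ) (𝓝 (G t)) := by
    refine comp_near h0 hg hG fun m => ?_
    rw [neg_div, Int.floor_neg, neg_neg]
    have h1 := Int.floor_le_ceil (t / h m)
    have h2 := Int.ceil_le_floor_add_one (t / h m)
    rw [← Int.cast_sub, ← Int.cast_abs]
    norm_cast
    rw [abs_le]
    constructor <;> linarith
  simp only [hodd] at h1
  exact tendsto_nhds_unique h1 (hG (-t)).neg

theorem hasDerivAt (hh : ∀ m, 0 < h m) (h0 : Tendsto h atTop (𝓝 0))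
    (hf : ∃ C, ∀ m i, |f m (i + 1) - f m i| ≤ C * h m)
    (hgf : ∀ m i, g m (i + 1) - g m i = h m * f m i)
    (hG : IsGridLimit h g G) (hF : IsGridLimit h f F) (s : ℝ) : HasDerivAt G (F s) s := by
  obtain ⟨C, hC⟩ := hf
  have hC0 : 0 ≤ C := by
    have := (abs_nonneg _).trans (hC 0 0)
    exact nonneg_of_mul_nonneg_left this (hh 0)
  refine hasDerivAt_of_abs_le_sq (C := 2 * C) fun t => ?_
  have ht := tendsto_floor_mul hh h0 t
  have hs := tendsto_floor_mul hh h0 s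
  refine le_of_tendsto_of_tendsto
    (((hG t).sub (hG s)).sub ((ht.sub hs).mul (hF s))).abs
    (((ht.sub hs).pow 2).const_mul (2 * C)) (Eventually.of_forall fun m => ?_)
  have := abs_taylor_le (hh m) hC0 (hC m) (hgf m) ⌊s / h m⌋ ⌊t / h m⌋
  simpa only [sub_mul] using this

end IsGridLimit

/-- A solution of the Lagrange equations in momentum form is a classical solution. -/
theorem isLagrangeSolution_of_hasDerivAt {x φ u v : ℝ → ℝ} (hx : ∀ t, HasDerivAt x (u t) t)
    (hφ : ∀ t, HasDerivAt φ (v t) t)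
    (hu : ∀ t, HasDerivAt u (x t * v t ^ 2 - sin (φ t)) t)
    (hp : ∀ t, HasDerivAt (fun t => (x t ^ 2 + 1) * v t) (-(x t * cos (φ t))) t) :
    IsLagrangeSolution tubeBallLagrangian x φ := by
  have dx : deriv x = u := funext fun t => (hx t).deriv
  have dφ : deriv φ = v := funext fun t => (hφ t).deriv
  have hpos : ∀ t, x t ^ 2 + 1 ≠ 0 := fun t => by positivity
  have hv : ∀ t, HasDerivAt v ((-(x t * cos (φ t)) * (x t ^ 2 + 1) -
      (x t ^ 2 + 1) * v t * (2 * x t * u t)) / (x t ^ 2 + 1) ^ 2) t := fun t => by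
    have h1 : HasDerivAt (fun t => x t ^ 2 + 1) (2 * x t * u t) t := by
      simpa using ((hx t).pow 2).add_const 1
    have := (hp t).div h1 (hpos t)
    refine this.congr_of_eventuallyEq (Eventually.of_forall fun s => ?_)
    exact (mul_div_cancel_left₀ _ (hpos s)).symm
  have cx : Continuous x := continuous_iff_continuousAt.2 fun t => (hx t).continuousAt
  have cφ : Continuous φ := continuous_iff_continuousAt.2 fun t => (hφ t).continuousAt
  have cu : Continuous u := continuous_iff_continuousAt.2 fun t => (hu t).continuousAt
  have cv : Continuous v := continuous_iff_continuousAt.2 fun t => (hv t).continuousAt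
  have c2 : ∀ {y z a : ℝ → ℝ}, (∀ t, HasDerivAt y (z t) t) → (∀ t, HasDerivAt z (a t) t) →
      Continuous a → ContDiff ℝ 2 y := by
    intro y z a hy hz ha
    have dy : deriv y = z := funext fun t => (hy t).deriv
    have dz : deriv z = a := funext fun t => (hz t).deriv
    rw [show (2 : WithTop ℕ∞) = 1 + 1 by norm_num, contDiff_succ_iff_deriv]
    refine ⟨fun t => (hy t).differentiableAt, by simp, ?_⟩
    rw [dy, contDiff_one_iff_deriv, dz]
    exact ⟨fun t => (hz t).differentiableAt, ha⟩
  have pv : ∀ q θ v w : ℝ, deriv (fun v => tubeBallLagrangian q θ v w) v = v := fun q θ v w => by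
    refine HasDerivAt.deriv ?_
    have := ((((hasDerivAt_id v).pow 2).const_mul (1 / 2)).const_add
      ((1 / 2) * (q ^ 2 + 1) * w ^ 2)).sub_const (q * sin θ)
    refine this.congr_deriv ?_
    simp
  have pw : ∀ q θ v w : ℝ, deriv (fun w => tubeBallLagrangian q θ v w) w = (q ^ 2 + 1) * w :=
    fun q θ v w => by
      refine HasDerivAt.deriv ?_
      have := ((((hasDerivAt_id w).pow 2).const_mul ((1 / 2) * (q ^ 2 + 1))).add_const
        ((1 / 2) * v ^ 2)).sub_const (q * sin θ)
      refine this.congr_deriv ?_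
      simp
      ring
  have pq : ∀ q θ v w : ℝ, deriv (fun q => tubeBallLagrangian q θ v w) q = q * w ^ 2 - sin θ :=
    fun q θ v w => by
      refine HasDerivAt.deriv ?_
      have := ((((((hasDerivAt_id q).pow 2).add_const 1).const_mul (1 / 2)).mul_const
        (w ^ 2)).add_const ((1 / 2) * v ^ 2)).sub ((hasDerivAt_id q).mul_const (sin θ))
      refine this.congr_deriv ?_
      simp
  have pθ : ∀ q θ v w : ℝ, deriv (fun θ => tubeBallLagrangian q θ v w) θ = -(q * cos θ) :=
    fun q θ v w => by
      refine HasDerivAt.deriv ?_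
      exact ((hasDerivAt_sin θ).const_mul q).const_sub
        ((1 / 2) * (q ^ 2 + 1) * w ^ 2 + (1 / 2) * v ^ 2)
  refine ⟨c2 hx hu (by fun_prop), c2 hφ hv ?_, fun t => ?_, fun t => ?_⟩
  · exact Continuous.div (by fun_prop) (by fun_prop) fun t => pow_ne_zero 2 (hpos t)
  · simp only [pv, pq, dx, dφ]
    exact hu t
  · simp only [pw, pθ, dx, dφ]
    exact hp t

/-- Existence of odd motions with prescribed period and winding number. -/
theorem exists_isOddPeriodicMotion {ω : ℝ} (hω : 0 < ω) (k : ℕ) :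
    ∃ x φ : ℝ → ℝ, IsOddPeriodicMotion ω k x φ := by
  obtain ⟨C, hC⟩ := exists_discrete_solution hω k
  choose x φ hx hφ hφn hgx hgφ hxC huC hvC using fun m : ℕ => hC (m + 1) m.succ_pos
  set h : ℕ → ℝ := fun m => ω / ((m + 1 : ℕ) : ℝ) with hdef
  have hh : ∀ m, 0 < h m := fun m => by positivity
  have h0 : Tendsto h atTop (𝓝 0) :=
    (tendsto_const_div_atTop_nhds_zero_nat ω).comp (tendsto_add_atTop_nat 1)
  set u : ℕ → ℤ → ℝ := fun m => diffQuot (h m) (x m) with hu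
  set v : ℕ → ℤ → ℝ := fun m => diffQuot (h m) (φ m) with hv
  have hslope : ∀ (g : ℕ → ℤ → ℝ) m i, g m (i + 1) - g m i = h m * diffQuot (h m) (g m) i :=
    fun g m i => by rw [diffQuot, mul_div_cancel₀ _ (hh m).ne']
  set fq : ℕ → ℤ → ℝ := fun m i => (-1) * (x m (i + 1) * cos (φ m (i + 1))) with hfq
  set fu : ℕ → ℤ → ℝ := fun m i => x m (i + 1) * ((1 / 2) * (v m (i + 1) * v m (i + 1) +
    v m i * v m i)) + (-1) * sin (φ m (i + 1)) with hfu
  set I : ℕ → ℤ → ℝ := fun m i => (1 / 2) * (x m i * x m i + x m (i + 1) * x m (i + 1)) + 1 with hI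
  have hI_eq : ∀ m i, I m i = inertia (x m) i := fun m i => by simp only [hI, inertia]; ring
  have hI1 : ∀ m i, 1 ≤ I m i := fun m i => (one_le_inertia _ _).trans_eq (hI_eq m i).symm
  set q : ℕ → ℤ → ℝ := fun m i => I m i * v m i with hq
  have hqf : ∀ m i, q m (i + 1) - q m i = h m * fq m i := fun m i => by
    have := hgφ m (i + 1)
    rw [gradφ, add_sub_cancel_right] at this
    simp only [hq, hfq, hI_eq]
    linarith
  have huf : ∀ m i, u m (i + 1) - u m i = h m * fu m i := fun m i => by
    have := hgx m (i + 1)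
    rw [gradX, add_sub_cancel_right] at this
    simp only [hu, hfu, hv]
    linarith
  have tx : Tame h x := .of_sub_eq hh ⟨C, huC⟩ ⟨C, hxC⟩ (hslope x)
  have lφ : ∃ C, ∀ m i, |φ m (i + 1) - φ m i| ≤ C * h m := ⟨C, fun m i => by
    rw [hslope φ, abs_mul, abs_of_pos (hh m), mul_comm]
    exact mul_le_mul_of_nonneg_right (hvC m i) (hh m).le⟩
  have tI : Tame h I := (((tx.mul tx).add (tx.shift.mul tx.shift)).const_mul _).add (.const 1)
  have tfq : Tame h fq := (tx.shift.mul (Tame.cos_comp lφ).shift).const_mul _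
  have tq : Tame h q := by
    refine .of_sub_eq hh tfq.bdd ?_ hqf
    obtain ⟨B, hB⟩ := tI.bdd
    exact ⟨B * C, fun m i => by
      rw [abs_mul]
      exact mul_le_mul (hB m i) (hvC m i) (abs_nonneg _) ((abs_nonneg _).trans (hB m i))⟩
  have tv : Tame h v := by
    have := (tI.inv hI1).mul tq
    have e : v = fun m i => (I m i)⁻¹ * q m i := by
      funext m i
      rw [hq]
      exact (inv_mul_cancel_left₀ (zero_lt_one.trans_le (hI1 m i)).ne' _).symm
    rwa [e]
  have tfu : Tame h fu := (tx.shift.mul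
    (((tv.shift.mul tv.shift).add (tv.mul tv)).const_mul _)).add
    ((Tame.sin_comp lφ).shift.const_mul _)
  have tu : Tame h u := .of_sub_eq hh tfu.bdd ⟨C, huC⟩ huf
  have lim : ∀ {g : ℕ → ℤ → ℝ}, Tame h g → ∃ G, IsGridLimit h g G := fun hg =>
    exists_isGridLimit fun t => hg.bdd.imp fun B hB m => hB m _
  obtain ⟨X, hX⟩ := lim tx
  obtain ⟨U, hU⟩ := lim tu
  obtain ⟨V, hV⟩ := lim tv
  obtain ⟨Φ, hΦ⟩ : ∃ Φ, IsGridLimit h φ Φ := by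
    refine exists_isGridLimit fun t => ?_
    obtain ⟨B, hB⟩ := lφ
    have hB0 : 0 ≤ B := nonneg_of_mul_nonneg_left ((abs_nonneg _).trans (hB 0 0)) (hh 0)
    refine ⟨B * (|t| + ω), fun m => ?_⟩
    have h1 := abs_sub_le_of_increment_int (hB m) 0 ⌊t / h m⌋
    have h2 : φ m 0 = 0 := by
      have := hφ m 0
      rw [neg_zero] at this
      linarith
    rw [h2, sub_zero, Int.cast_zero, sub_zero] at h1
    have h3 : |(⌊t / h m⌋ : ℝ)| * h m ≤ |t| + ω := by
      have a := abs_floor_mul_sub_le (t := t) (hh m)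
      have b := abs_add_le (⌊t / h m⌋ * h m - t) t
      rw [sub_add_cancel, abs_mul, abs_of_pos (hh m)] at b
      have c : h m ≤ ω := div_le_self hω.le (by exact_mod_cast m.succ_pos)
      linarith
    calc _ ≤ _ := h1
      _ = B * (|(⌊t / h m⌋ : ℝ)| * h m) := by ring
      _ ≤ _ := by gcongr
  have hX' := hX.shift h0 tx.lip
  have hV' := hV.shift h0 tv.lip
  have hΦ' := hΦ.shift h0 lφ
  have hQ : IsGridLimit h q (fun t => (X t ^ 2 + 1) * V t) := fun t => by
    have := (((((hX t).mul (hX t)).add ((hX' t).mul (hX' t))).const_mul (1 / 2)).add_const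
      1).mul (hV t)
    refine Eq.subst (motive := fun y => Tendsto _ _ (𝓝 y)) ?_ this
    dsimp only
    ring
  have hFu : IsGridLimit h fu (fun t => X t * V t ^ 2 - sin (Φ t)) := fun t => by
    have := ((hX' t).mul ((((hV' t).mul (hV' t)).add ((hV t).mul (hV t))).const_mul (1 / 2))).add
      (((continuous_sin.tendsto _).comp (hΦ' t)).const_mul (-1))
    refine Eq.subst (motive := fun y => Tendsto _ _ (𝓝 y)) ?_ this
    dsimp only
    ring
  have hFq : IsGridLimit h fq (fun t => -(X t * cos (Φ t))) := fun t => by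
    have := ((hX' t).mul ((continuous_cos.tendsto _).comp (hΦ' t))).const_mul (-1)
    refine Eq.subst (motive := fun y => Tendsto _ _ (𝓝 y)) ?_ this
    dsimp only
    ring
  have floor_add : ∀ t m, ⌊(t + ω) / h m⌋ = ⌊t / h m⌋ + ((m + 1 : ℕ) : ℤ) := fun t m => by
    rw [← Int.floor_add_natCast]
    congr 1
    simp only [hdef]
    field_simp
  refine ⟨X, Φ, isLagrangeSolution_of_hasDerivAt (u := U) (v := V)
    (hX.hasDerivAt hh h0 tu.lip (hslope x) hU) (hΦ.hasDerivAt hh h0 tv.lip (hslope φ) hV)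
    (hU.hasDerivAt hh h0 tfu.lip huf hFu) (hQ.hasDerivAt hh h0 tfq.lip hqf hFq),
    hX.odd h0 tx.lip fun m => (hx m).odd, hΦ.odd h0 lφ hφ, fun t => ?_, fun t => ?_⟩
  · refine tendsto_nhds_unique (hX (t + ω)) ?_
    simp only [floor_add, (hx _).period _]
    exact hX t
  · refine tendsto_nhds_unique (hΦ (t + ω)) ?_
    simp only [floor_add, hφn]
    exact (hΦ t).add_const _

theorem theorem1p1 :
    (∀ (ω : ℝ) (_ : 0 < ω) (k : ℕ), ∃ x φ : ℝ → ℝ, IsOddPeriodicMotion ω k x φ) ∧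
    (∀ (ω₁ ω₂ : ℝ) (_ : 0 < ω₁) (_ : 0 < ω₂) (k₁ k₂ : ℕ) (x₁ φ₁ x₂ φ₂ : ℝ → ℝ)
      (h₁ : IsOddPeriodicMotion ω₁ k₁ x₁ φ₁) (h₂ : IsOddPeriodicMotion ω₂ k₂ x₂ φ₂),
      k₁ ≠ k₂ → ¬ ContinuousMap.Homotopic h₁.loop h₂.loop) :=
  ⟨fun _ hω k => exists_isOddPeriodicMotion hω k,
    fun _ _ _ _ _ _ _ _ _ _ h₁ h₂ hk hom => hk (h₁.eq_of_homotopic h₂ hom)⟩
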